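/- Fix a relational signature $\mathbb S$ (predicates of arbitrary arities $\ge 0$) and a binary predicate $E\in\mathbb S$. A rule set is a set of existential rules $\forall \vec x,\vec y\,\big(B(\vec x,\vec y)\to\exists\vec z\,H(\vec y,\vec z)\big)$ with $B,H$ finite conjunctions of atoms over $\mathbb S$ (the empty conjunction stands for the always true nullary atom $\top$). An instance is a set of atoms over a countably infinite set of variables; its elements are the variables occurring in it. Write $(I,R)\models\varphi$ if every structure that interprets the elements of $I$ (not necessarily injectively) and satisfies all atoms of $I$ and all rules of $R$ satisfies $\varphi$. Let $\mathrm{Step}_k(I,R)$ be the result of $k$ rounds of the oblivious chase from $I$. The rule set $R$ is bdd (has bounded derivation depth) if for every conjunctive query $q(\vec x)$ there is $k$ such that, for all instances $I$ and all tuples $\vec t$ of elements of $I$, $(I,R)\models q(\vec t)$ if and only if $\mathrm{Step}_k(I,R)\models q(\vec t)$. It is UCQ-rewritable if for every conjunctive query $q(\vec x)$ there is a finite union $Q(\vec x)$ of conjunctive queries such that, for all $I$ and $\vec t$ as before, $(I,R)\models q(\vec t)$ if and only if $I\models Q(\vec t)$. (These two properties are known to be equivalent.) **Theorem.** Let $R$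 be a finite rule set that is bdd or UCQ-rewritable, and let $I$ be a finite instance. Suppose that $(I,R)$ entails $E$-tournaments of every finite size, that is, in every model of $(I,R)$ there are, for every $k$, values $x_1,\dots,x_k$ such that $E(x_i,x_j)$ or $E(x_j,x_i)$ holds for all $i\ne j$ (two of the values may coincide, but then that element carries an $E$-loop). Then $(I,R)\models\exists x\,E(x,x)$. Consequently, if a universal model of $(I,R)$ (a model that maps homomorphically to every model) contains, for every $k$, a set of $k$ distinct elements any two distinct ones of which are joined by an $E$-edge in at least one direction, then it contains an element $x$ with $E(x,x)$. -/

import Mathlib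

namespace ExRules

/-- A relational signature: predicates, each with an arity (possibly zero). -/
structure Signature where
  Pred : Type
  arity : Pred → ℕ

/-- An atom `P(v₁, …, vₙ)` with arguments from `V`. -/
structure Atom (S : Signature) (V : Type) where
  pred : S.Pred
  args : Fin (S.arity pred) → V

namespace Atom

/-- Apply a substitution to the arguments of an atom. -/
def map {S : Signature} {V W : Type} (f : V → W) (a : Atom S V) : Atom S W :=
  ⟨a.pred, fun i => f (a.args i)⟩

/-- The elements that occur in an atom. -/
def vars {S : Signature} {V : Type} (a : Atom S V) : Set V := Set.range a.args

/-- The atom `E(u, v)` of a binary predicate `E`. -/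
def binary {S : Signature} {V : Type} (E : S.Pred) (hE : S.arity E = 2) (u v : V) : Atom S V :=
  ⟨E, fun i => ![u, v] (Fin.cast hE i)⟩

end Atom

/-- The active domain of a set of atoms. -/
def adom {S : Signature} {V : Type} (A : Set (Atom S V)) : Set V :=
  {v | ∃ a ∈ A, v ∈ a.vars}

/-- An instance is a (finite or infinite) set of atoms over the countably infinite set `ℕ` of
variables. More generally, a set of atoms over a type `M` is the same thing as a relational
structure with domain `M`. -/
abbrev Instance (S : Signature) : Type := Set (Atom S ℕ)

/-- An existential rule `∀ x y, B(x, y) → ∃ z, H(y, z)`: the existential variables are the variables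
of the head that do not occur in the body. The empty conjunction stands for the always true nullary
atom `⊤`. -/
structure Rule (S : Signature) where
  body : List (Atom S ℕ)
  head : List (Atom S ℕ)

namespace Rule

/-- The (universally quantified) variables of the body of a rule. -/
def bodyVars {S : Signature} (ρ : Rule S) : Set ℕ := {x | ∃ a ∈ ρ.body, x ∈ a.vars}

/-- The structure with domain `M` and set of true atoms `A` satisfies the rule, read as a
first-order sentence. -/
def Satisfied {S : Signature} {M : Type} (ρ : Rule S) (A : Set (Atom S M)) : Prop :=
  ∀ h : ℕ → M, (∀ a ∈ ρ.body, a.map h ∈ A) →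
    ∃ h' : ℕ → M, (∀ x ∈ ρ.bodyVars, h' x = h x) ∧ ∀ a ∈ ρ.head, a.map h' ∈ A

end Rule

/-- A conjunctive query with `n` answer variables (repetitions allowed), each of which occurs in the
body; all other variables of the body are existentially quantified. -/
structure CQ (S : Signature) (n : ℕ) where
  body : List (Atom S ℕ)
  ans : Fin n → ℕ
  ans_mem : ∀ i, ∃ a ∈ body, ans i ∈ a.vars

/-- The query `q(t)` holds in the structure `A`. -/
def CQ.Holds {S : Signature} {n : ℕ} {M : Type} (q : CQ S n) (A : Set (Atom S M))
    (t : Fin n → M) : Prop :=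
  ∃ h : ℕ → M, (∀ i, h (q.ans i) = t i) ∧ ∀ a ∈ q.body, a.map h ∈ A

/-- A union of conjunctive queries with `n` answer variables: a finite disjunction. As the answer
variables of a disjunct may be repeated, a disjunct may identify answer variables. -/
abbrev UCQ (S : Signature) (n : ℕ) : Type := List (CQ S n)

/-- The union of conjunctive queries `Q(t)` holds in the structure `A`. -/
def UCQ.Holds {S : Signature} {n : ℕ} {M : Type} (Q : UCQ S n) (A : Set (Atom S M))
    (t : Fin n → M) : Prop :=
  ∃ q ∈ Q, CQ.Holds q A t

/-- The structure `A` with domain `M`, in which the variables of the instance are interpreted by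
`c`, is a model of `I` and `R`. The domain is non-empty because of `c`. -/
structure IsModel {S : Signature} (I : Instance S) (R : Set (Rule S)) {M : Type}
    (A : Set (Atom S M)) (c : ℕ → M) : Prop where
  inst : ∀ a ∈ I, a.map c ∈ A
  rules : ∀ ρ ∈ R, ρ.Satisfied A

/-- `(I, R) ⊨ q(t)`: the query holds in all models. -/
def Entails {S : Signature} (I : Instance S) (R : Set (Rule S)) {n : ℕ} (q : CQ S n)
    (t : Fin n → ℕ) : Prop :=
  ∀ (M : Type) (A : Set (Atom S M)) (c : ℕ → M), IsModel I R A c → q.Holds A (fun i => c (t i))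

/-- Terms of the chase: the variables of the instance, and for every trigger `(ρ, h)` and every
existential variable `z` of `ρ` a fresh term that is determined by `ρ`, `h` and `z`. -/
inductive ChaseTerm (S : Signature) : Type
  | var (x : ℕ) : ChaseTerm S
  | null (ρ : Rule S) (h : ρ.bodyVars → ChaseTerm S) (z : ℕ) : ChaseTerm S

open Classical in
/-- The extension of a map on the body variables of `ρ` that sends every existential variable to its
fresh term. -/
noncomputable def Rule.extend {S : Signature} (ρ : Rule S) (h : ρ.bodyVars → ChaseTerm S) :
    ℕ → ChaseTerm S :=
  fun x => if hx : x ∈ ρ.bodyVars then h ⟨x, hx⟩ else ChaseTerm.null ρ h x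

/-- `(ρ, h)` is a trigger over `A`: the map `h` is a homomorphism from the body of `ρ` to `A`. -/
def IsTrigger {S : Signature} (A : Set (Atom S (ChaseTerm S))) (ρ : Rule S)
    (h : ρ.bodyVars → ChaseTerm S) : Prop :=
  ∀ a ∈ ρ.body, a.map (ρ.extend h) ∈ A

/-- The `k`-th step of the oblivious chase. A trigger that has been applied before contributes
nothing new when it is applied again, as its fresh terms are determined by it. -/
noncomputable def chaseStep {S : Signature} (I : Instance S) (R : Set (Rule S)) :
    ℕ → Set (Atom S (ChaseTerm S))
  | 0 => {b | ∃ a ∈ I, b = a.map ChaseTerm.var}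
  | k + 1 => chaseStep I R k ∪
      {b | ∃ ρ ∈ R, ∃ h : ρ.bodyVars → ChaseTerm S, IsTrigger (chaseStep I R k) ρ h ∧
        ∃ a ∈ ρ.head, b = a.map (ρ.extend h)}

/-- Bounded derivation depth (bdd). -/
def IsBDD {S : Signature} (R : Set (Rule S)) : Prop :=
  ∀ (n : ℕ) (q : CQ S n), ∃ k : ℕ, ∀ (I : Instance S) (t : Fin n → ℕ), (∀ i, t i ∈ adom I) →
    (Entails I R q t ↔ q.Holds (chaseStep I R k) (fun i => ChaseTerm.var (t i)))

/-- UCQ-rewritability. -/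
def IsUCQRewritable {S : Signature} (R : Set (Rule S)) : Prop :=
  ∀ (n : ℕ) (q : CQ S n), ∃ Q : UCQ S n, ∀ (I : Instance S) (t : Fin n → ℕ),
    (∀ i, t i ∈ adom I) → (Entails I R q t ↔ UCQ.Holds Q I t)

/-- The loop query `∃ x, E(x, x)`. -/
def HasLoop {S : Signature} (E : S.Pred) (hE : S.arity E = 2) {M : Type}
    (A : Set (Atom S M)) : Prop :=
  ∃ x : M, Atom.binary E hE x x ∈ A

/-- The tournament query of size `k`: there are `x₁, …, xₖ` such that `E(xᵢ, xⱼ)` or `E(xⱼ, xᵢ)` for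
all `i ≠ j`. As usual for a query, two of the variables may take the same value, but only a value
that carries a loop. -/
def TournamentQuery {S : Signature} (E : S.Pred) (hE : S.arity E = 2) {M : Type}
    (A : Set (Atom S M)) (k : ℕ) : Prop :=
  ∃ x : Fin k → M, ∀ i j, i ≠ j →
    Atom.binary E hE (x i) (x j) ∈ A ∨ Atom.binary E hE (x j) (x i) ∈ A

/-- The structure contains an `E`-tournament on `k` distinct elements. -/
def ContainsTournament {S : Signature} (E : S.Pred) (hE : S.arity E = 2) {M : Type}
    (A : Set (Atom S M)) (k : ℕ) : Prop :=
  ∃ T : Finset M, T.card = k ∧ ∀ u ∈ T, ∀ v ∈ T, u ≠ v →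
    Atom.binary E hE u v ∈ A ∨ Atom.binary E hE v u ∈ A

/-- `(I, R)` entails the loop query. -/
def EntailsLoop {S : Signature} (E : S.Pred) (hE : S.arity E = 2) (I : Instance S)
    (R : Set (Rule S)) : Prop :=
  ∀ (M : Type) (A : Set (Atom S M)) (c : ℕ → M), IsModel I R A c → HasLoop E hE A

/-- `(I, R)` entails `E`-tournaments of every finite size. -/
def EntailsTournaments {S : Signature} (E : S.Pred) (hE : S.arity E = 2) (I : Instance S)
    (R : Set (Rule S)) : Prop :=
  ∀ (M : Type) (A : Set (Atom S M)) (c : ℕ → M), IsModel I R A c →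
    ∀ k : ℕ, TournamentQuery E hE A k

/-- A universal model of `I` and `R`: a model that maps homomorphically to every model. As variables
of the instance are not constants, a homomorphism is not required to fix them. -/
def IsUniversalModel {S : Signature} (I : Instance S) (R : Set (Rule S)) {M : Type}
    (A : Set (Atom S M)) (c : ℕ → M) : Prop :=
  IsModel I R A c ∧
    ∀ (M' : Type) (A' : Set (Atom S M')) (c' : ℕ → M'), IsModel I R A' c' →
      ∃ f : M → M', ∀ a ∈ A, a.map f ∈ A'

end ExRules

/-!
Let `C` be the oblivious chase of `(I, R)`, and assume that it contains `E`-tournaments of every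
size. As `C` is a model that maps to all models, it suffices to find a loop in `C`.

Bounded derivation depth and UCQ-rewritability are used only through locality
(`exists_forces_finset`): there is a number `N` such that every finite set of atoms that entails an
edge `E(u, v)` under `R` has a subset of at most `N` atoms that does so, too.

Call an atom of `C` a core atom if it belongs to `I` or contains a fresh term of the trigger that
has produced it. All other atoms of `C` follow from core atoms, so every edge `E(u, v)` of `C` is
entailed by some set of at most `N` core atoms. Among these sets, take one whose atoms occur as
early as possible in the chase. Suppose that the fresh terms of a trigger `τ` are different from `u`
and `v` and occur in no atom of the set that another trigger has produced. Then the atoms from `τ`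
can be replaced by core atoms that precede `τ` (`Forces.replace`), contrary to the choice of the
set. So from each atom of the set that is not in `I`, one reaches `u` or `v` by passing repeatedly
from the trigger of an atom to an atom with one of its fresh terms (`exists_realizes`). As a fresh
term determines its trigger, `u` determines all terms in the atoms from which it is reached, once
the isomorphism type of the set with its sources in `I` and `R` is known
(`Pattern.Connected.eq_of_realizes`); likewise for `v`.

There are finitely many such types because `I` and `R` are finite. By Ramsey's theorem, a large
tournament contains a transitive triangle `a → b`, `a → d`, `b → d` whose edges have the same type.
The atoms for `b → d` that are connected to the source `b` and the atoms for `a → b` that are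
connected to the target `b` together are a homomorphic image of an entailing set for `a → b` in
which both ends are mapped to `b`; they agree on the terms that are connected to both ends, by
comparison with `a → d`. Hence `E(b, b)` holds in `C` (`loop_mem_chase_of_triangle`).
-/

namespace ExRules

variable {S : Signature}

/-! ### Atoms, active domains and models -/

theorem Atom.map_map {V W U : Type} (f : V → W) (g : W → U) (a : Atom S V) :
    (a.map f).map g = a.map (g ∘ f) := rfl

theorem Atom.map_congr {V W : Type} {f g : V → W} {a : Atom S V}
    (h : ∀ x ∈ a.vars, f x = g x) : a.map f = a.map g := by
  unfold Atom.map
  congr 1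
  funext i
  exact h _ ⟨i, rfl⟩

theorem Atom.map_eq_self {V : Type} {f : V → V} {a : Atom S V}
    (h : ∀ x ∈ a.vars, f x = x) : a.map f = a :=
  Atom.map_congr (g := id) h

theorem Atom.mem_vars_map {V W : Type} {f : V → W} {a : Atom S V} {w : W} :
    w ∈ (a.map f).vars ↔ ∃ x ∈ a.vars, f x = w := by
  constructor
  · rintro ⟨i, rfl⟩
    exact ⟨a.args i, ⟨i, rfl⟩, rfl⟩
  · rintro ⟨x, ⟨i, rfl⟩, rfl⟩
    exact ⟨i, rfl⟩

theorem Atom.map_binary {V W : Type} (E : S.Pred) (hE : S.arity E = 2) (f : V → W) (u v : V) :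
    (Atom.binary E hE u v).map f = Atom.binary E hE (f u) (f v) := by
  unfold Atom.map Atom.binary
  congr 1
  funext i
  change f (![u, v] (Fin.cast hE i)) = _
  generalize Fin.cast hE i = j
  fin_cases j <;> rfl

theorem Atom.left_mem_vars_binary {V : Type} (E : S.Pred) (hE : S.arity E = 2) (u v : V) :
    u ∈ (Atom.binary E hE u v).vars :=
  ⟨Fin.cast hE.symm 0, by simp [Atom.binary]⟩

theorem Atom.right_mem_vars_binary {V : Type} (E : S.Pred) (hE : S.arity E = 2) (u v : V) :
    v ∈ (Atom.binary E hE u v).vars :=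
  ⟨Fin.cast hE.symm 1, by simp [Atom.binary]⟩

theorem adom_mono {V : Type} {X Y : Set (Atom S V)} (h : X ⊆ Y) : adom X ⊆ adom Y :=
  fun _ ⟨a, ha, hv⟩ => ⟨a, h ha, hv⟩

theorem finite_adom {V : Type} {X : Set (Atom S V)} (hX : X.Finite) : (adom X).Finite := by
  have : adom X = ⋃ a ∈ X, a.vars := by
    ext v
    simp [adom]
  rw [this]
  exact hX.biUnion fun a _ => Set.finite_range _

/-- Every structure that satisfies the rules `R` and, under some interpretation of the elements, the
atoms `X`, also satisfies `E(u, v)`. In contrast to `Entails`, the elements of `X` need not be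
natural numbers. -/
def Forces (E : S.Pred) (hE : S.arity E = 2) (R : Set (Rule S)) {V : Type} (X : Set (Atom S V))
    (u v : V) : Prop :=
  ∀ (M : Type) (A : Set (Atom S M)) (c : V → M), (∀ a ∈ X, a.map c ∈ A) →
    (∀ ρ ∈ R, ρ.Satisfied A) → Atom.binary E hE (c u) (c v) ∈ A

/-- The atomic query `E(x, y)`. -/
def edgeQuery (E : S.Pred) (hE : S.arity E = 2) : CQ S 2 where
  body := [Atom.binary E hE 0 1]
  ans := ![0, 1]
  ans_mem := by
    intro i
    refine ⟨_, List.mem_singleton_self _, ?_⟩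
    fin_cases i
    · exact Atom.left_mem_vars_binary E hE 0 1
    · exact Atom.right_mem_vars_binary E hE 0 1

theorem edgeQuery_holds {E : S.Pred} {hE : S.arity E = 2} {M : Type} {A : Set (Atom S M)}
    {t : Fin 2 → M} : (edgeQuery E hE).Holds A t ↔ Atom.binary E hE (t 0) (t 1) ∈ A := by
  constructor
  · rintro ⟨h, h₁, h₂⟩
    have := h₂ _ (List.mem_singleton_self _)
    rw [Atom.map_binary] at this
    rw [← h₁ 0, ← h₁ 1]
    exact this
  · intro h
    refine ⟨fun n => if n = 0 then t 0 else t 1, fun i => ?_, fun a ha => ?_⟩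
    · fin_cases i <;> rfl
    · rw [List.mem_singleton.1 ha, Atom.map_binary]
      exact h

theorem entails_edgeQuery {E : S.Pred} {hE : S.arity E = 2} {R : Set (Rule S)} {I : Instance S}
    {t : Fin 2 → ℕ} : Entails I R (edgeQuery E hE) t ↔ Forces E hE R I (t 0) (t 1) := by
  constructor
  · intro h M A c hc hA
    exact edgeQuery_holds.1 (h M A c ⟨hc, hA⟩)
  · intro h M A c hc
    exact edgeQuery_holds.2 (h M A c hc.inst hc.rules)

/-! ### The oblivious chase -/

theorem Rule.extend_of_mem {ρ : Rule S} (h : ρ.bodyVars → ChaseTerm S) {x : ℕ}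
    (hx : x ∈ ρ.bodyVars) : ρ.extend h x = h ⟨x, hx⟩ := by
  simp [Rule.extend, hx]

theorem Rule.extend_of_notMem {ρ : Rule S} (h : ρ.bodyVars → ChaseTerm S) {x : ℕ}
    (hx : x ∉ ρ.bodyVars) : ρ.extend h x = ChaseTerm.null ρ h x := by
  simp [Rule.extend, hx]

theorem Rule.finite_bodyVars (ρ : Rule S) : ρ.bodyVars.Finite := by
  have : ρ.bodyVars = ⋃ a ∈ {a | a ∈ ρ.body}, a.vars := by
    ext v
    simp [Rule.bodyVars]
  rw [this]
  exact (List.finite_toSet ρ.body).biUnion fun a _ => Set.finite_range _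

theorem ChaseTerm.apply_ne_null (ρ : Rule S) (h : ρ.bodyVars → ChaseTerm S) (z : ℕ)
    (x : ρ.bodyVars) : h x ≠ ChaseTerm.null ρ h z := by
  have key : ∀ t : ChaseTerm S, ∀ (ρ : Rule S) (h : ρ.bodyVars → ChaseTerm S) (z : ℕ)
      (x : ρ.bodyVars), t = ChaseTerm.null ρ h z → h x ≠ t := by
    intro t
    induction t with
    | var y => intro ρ h z x ht; cases ht
    | null ρ' h' z' ih =>
      intro ρ h z x ht hx
      cases ht
      exact ih x _ _ _ x hx rfl
  exact key _ ρ h z x rfl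

theorem chaseStep_mono {I : Instance S} {R : Set (Rule S)} : Monotone (chaseStep I R) :=
  monotone_nat_of_le_succ fun _ => Set.subset_union_left

theorem chaseStep_mono_instance {I J : Instance S} {R : Set (Rule S)} (hIJ : I ⊆ J) (k : ℕ) :
    chaseStep I R k ⊆ chaseStep J R k := by
  induction k with
  | zero =>
    rintro b ⟨a, ha, rfl⟩
    exact ⟨a, hIJ ha, rfl⟩
  | succ k ih =>
    rintro b (hb | ⟨ρ, hρ, h, ht, a, ha, rfl⟩)
    · exact Or.inl (ih hb)
    · exact Or.inr ⟨ρ, hρ, h, fun a ha => ih (ht a ha), a, ha, rfl⟩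

theorem IsTrigger.mem_adom {A : Set (Atom S (ChaseTerm S))} {ρ : Rule S}
    {h : ρ.bodyVars → ChaseTerm S} (ht : IsTrigger A ρ h) (x : ρ.bodyVars) : h x ∈ adom A := by
  obtain ⟨x, hx⟩ := x
  have hx' := hx
  obtain ⟨a, ha, hxa⟩ := hx'
  exact ⟨_, ht a ha, Atom.mem_vars_map.2 ⟨x, hxa, Rule.extend_of_mem h hx⟩⟩

theorem finite_chaseStep {I : Instance S} {R : Set (Rule S)} (hI : I.Finite) (hR : R.Finite)
    (k : ℕ) : (chaseStep I R k).Finite := by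
  induction k with
  | zero =>
    refine (hI.image fun a => a.map ChaseTerm.var).subset ?_
    rintro b ⟨a, ha, rfl⟩
    exact ⟨a, ha, rfl⟩
  | succ k ih =>
    refine ih.union ?_
    have : {b | ∃ ρ ∈ R, ∃ h : ρ.bodyVars → ChaseTerm S, IsTrigger (chaseStep I R k) ρ h ∧
        ∃ a ∈ ρ.head, b = a.map (ρ.extend h)} ⊆
        ⋃ ρ ∈ R, ⋃ h ∈ {h : ρ.bodyVars → ChaseTerm S | ∀ x, h x ∈ adom (chaseStep I R k)},
          ⋃ a ∈ {a | a ∈ ρ.head}, {a.map (ρ.extend h)} := by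
      rintro b ⟨ρ, hρ, h, ht, a, ha, rfl⟩
      simp only [Set.mem_iUnion]
      exact ⟨ρ, hρ, h, ht.mem_adom, a, ha, rfl⟩
    refine Set.Finite.subset ?_ this
    refine hR.biUnion fun ρ _ => Set.Finite.biUnion ?_ fun h _ =>
      (List.finite_toSet ρ.head).biUnion fun a _ => Set.finite_singleton _
    have := ρ.finite_bodyVars.to_subtype
    have h' := Set.Finite.pi' (ι := ρ.bodyVars) fun _ => finite_adom ih
    exact h'

/-- A fresh term is introduced only by its own trigger, which was therefore applicable before. -/
theorem exists_isTrigger_of_null_mem {I : Instance S} {R : Set (Rule S)} {ρ : Rule S}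
    {h : ρ.bodyVars → ChaseTerm S} {z k : ℕ}
    (hz : ChaseTerm.null ρ h z ∈ adom (chaseStep I R k)) :
    ∃ j, k = j + 1 ∧ IsTrigger (chaseStep I R j) ρ h := by
  induction k with
  | zero =>
    obtain ⟨b, ⟨a, ha, rfl⟩, hz⟩ := hz
    obtain ⟨x, -, hx⟩ := Atom.mem_vars_map.1 hz
    cases hx
  | succ k ih =>
    refine ⟨k, rfl, ?_⟩
    have old : ChaseTerm.null ρ h z ∈ adom (chaseStep I R k) →
        IsTrigger (chaseStep I R k) ρ h := by
      intro hz
      obtain ⟨j, rfl, hj⟩ := ih hz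
      exact fun a ha => chaseStep_mono (Nat.le_succ j) (hj a ha)
    obtain ⟨b, hb | ⟨ρ', hρ', h', ht, a, ha, rfl⟩, hzb⟩ := hz
    · exact old ⟨b, hb, hzb⟩
    · obtain ⟨x, -, hx⟩ := Atom.mem_vars_map.1 hzb
      by_cases hxb : x ∈ ρ'.bodyVars
      · rw [Rule.extend_of_mem h' hxb] at hx
        exact old (hx ▸ ht.mem_adom ⟨x, hxb⟩)
      · rw [Rule.extend_of_notMem h' hxb] at hx
        cases hx
        exact ht

/-- The result of the oblivious chase. -/
def chase (I : Instance S) (R : Set (Rule S)) : Set (Atom S (ChaseTerm S)) :=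
  ⋃ k, chaseStep I R k

theorem isModel_chase (I : Instance S) (R : Set (Rule S)) :
    IsModel I R (chase I R) ChaseTerm.var where
  inst a ha := Set.mem_iUnion.2 ⟨0, a, ha, rfl⟩
  rules ρ hρ h hh := by
    have hk : ∃ k, ∀ a ∈ ρ.body, a.map h ∈ chaseStep I R k := by
      have : ∀ l : List (Atom S ℕ), (∀ a ∈ l, a.map h ∈ chase I R) →
          ∃ k, ∀ a ∈ l, a.map h ∈ chaseStep I R k := by
        intro l
        induction l with
        | nil => simp
        | cons a l ih =>
          intro hl
          obtain ⟨k, hk⟩ := ih fun b hb => hl b (List.mem_cons_of_mem _ hb)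
          obtain ⟨j, hj⟩ := Set.mem_iUnion.1 (hl a List.mem_cons_self)
          refine ⟨max j k, fun b hb => ?_⟩
          rcases List.mem_cons.1 hb with rfl | hb
          · exact chaseStep_mono (le_max_left _ _) hj
          · exact chaseStep_mono (le_max_right _ _) (hk b hb)
      exact this _ hh
    obtain ⟨k, hk⟩ := hk
    refine ⟨ρ.extend fun x => h x, fun x hx => Rule.extend_of_mem _ hx, fun a ha => ?_⟩
    refine Set.mem_iUnion.2 ⟨k + 1, Or.inr ⟨ρ, hρ, _, fun b hb => ?_, a, ha, rfl⟩⟩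
    rw [Atom.map_congr (g := h) fun x hx => Rule.extend_of_mem _ ⟨b, hb, hx⟩]
    exact hk b hb

open Classical in
/-- Values for the variables of `ρ` that extend `p` and satisfy the head of `ρ` in `A`, if there are
any (and the constant `d` otherwise). -/
noncomputable def Rule.headValues {M : Type} (A : Set (Atom S M)) (d : M) (ρ : Rule S)
    (p : ρ.bodyVars → M) : ℕ → M :=
  if h : ∃ h' : ℕ → M, (∀ x : ρ.bodyVars, h' x = p x) ∧ ∀ a ∈ ρ.head, a.map h' ∈ A then h.choose
  else fun _ => d

/-- The homomorphism from the chase to a model `A` in which the variables of the instance are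
interpreted by `c`. -/
noncomputable def chaseHom {M : Type} (A : Set (Atom S M)) (c : ℕ → M) : ChaseTerm S → M
  | .var x => c x
  | .null ρ h z => ρ.headValues A (c 0) (fun x => chaseHom A c (h x)) z

theorem map_chaseHom_mem_of_mem_chaseStep {I : Instance S} {R : Set (Rule S)} {M : Type}
    {A : Set (Atom S M)} {c : ℕ → M} (hA : IsModel I R A c) {k : ℕ} {b : Atom S (ChaseTerm S)}
    (hb : b ∈ chaseStep I R k) : b.map (chaseHom A c) ∈ A := by
  induction k generalizing b with
  | zero =>
    obtain ⟨a, ha, rfl⟩ := hb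
    exact hA.inst a ha
  | succ k ih =>
    rcases hb with hb | ⟨ρ, hρ, h, ht, a, ha, rfl⟩
    · exact ih hb
    · have ex : ∃ h' : ℕ → M, (∀ x : ρ.bodyVars, h' x = chaseHom A c (h x)) ∧
          ∀ a ∈ ρ.head, a.map h' ∈ A := by
        obtain ⟨h', h₁, h₂⟩ := hA.rules ρ hρ (chaseHom A c ∘ ρ.extend h) fun b hb => ih (ht b hb)
        refine ⟨h', fun x => ?_, h₂⟩
        rw [h₁ x x.2, Function.comp_apply, Rule.extend_of_mem h x.2]
      rw [Atom.map_map, Atom.map_congr (g := ex.choose)]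
      · exact ex.choose_spec.2 a ha
      · intro x _
        by_cases hx : x ∈ ρ.bodyVars
        · rw [Function.comp_apply, Rule.extend_of_mem h hx, ex.choose_spec.1 ⟨x, hx⟩]
        · rw [Function.comp_apply, Rule.extend_of_notMem h hx, chaseHom, Rule.headValues,
            dif_pos ex]

/-! ### Entailed edges have entailing sets of bounded size -/

theorem exists_finset_subset_mem_chaseStep {R : Set (Rule S)} (hR : R.Finite) (k : ℕ) :
    ∃ N : ℕ, ∀ (J : Instance S) (b : Atom S (ChaseTerm S)), b ∈ chaseStep J R k →
      ∃ J₀ : Finset (Atom S ℕ), ↑J₀ ⊆ J ∧ J₀.card ≤ N ∧ b ∈ chaseStep ↑J₀ R k := by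
  classical
  obtain ⟨B, hB⟩ := (hR.image fun ρ => ρ.body.length).bddAbove
  induction k with
  | zero =>
    refine ⟨1, ?_⟩
    rintro J b ⟨a, ha, rfl⟩
    exact ⟨{a}, by simpa using ha, by simp, a, by simp, rfl⟩
  | succ k ih =>
    obtain ⟨N, hN⟩ := ih
    refine ⟨N + B * N, ?_⟩
    rintro J b (hb | ⟨ρ, hρ, h, ht, a, ha, rfl⟩)
    · obtain ⟨J₀, h₁, h₂, h₃⟩ := hN J b hb
      exact ⟨J₀, h₁, by omega, Or.inl h₃⟩
    · have hch : ∀ a ∈ ρ.body, ∃ J₀ : Finset (Atom S ℕ), ↑J₀ ⊆ J ∧ J₀.card ≤ N ∧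
          a.map (ρ.extend h) ∈ chaseStep ↑J₀ R k := fun a ha => hN J _ (ht a ha)
      choose! F hF₁ hF₂ hF₃ using hch
      refine ⟨ρ.body.toFinset.biUnion F, ?_, ?_, Or.inr ⟨ρ, hρ, h, fun b hb => ?_, a, ha, rfl⟩⟩
      · intro x hx
        obtain ⟨b, hb, hx⟩ := Finset.mem_biUnion.1 (Finset.mem_coe.1 hx)
        exact hF₁ b (List.mem_toFinset.1 hb) hx
      · calc _ ≤ ρ.body.toFinset.card * N :=
              Finset.card_biUnion_le_card_mul _ _ _ fun b hb => hF₂ b (List.mem_toFinset.1 hb)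
          _ ≤ B * N := Nat.mul_le_mul_right _
              ((List.toFinset_card_le _).trans (hB ⟨ρ, hρ, rfl⟩))
          _ ≤ N + B * N := Nat.le_add_left _ _
      · refine chaseStep_mono_instance ?_ k (hF₃ b hb)
        intro x hx
        exact Finset.mem_coe.2 (Finset.mem_biUnion.2 ⟨b, List.mem_toFinset.2 hb, hx⟩)

theorem exists_forces_of_isBDD {E : S.Pred} {hE : S.arity E = 2} {R : Set (Rule S)}
    (hR : R.Finite) (h : IsBDD R) :
    ∃ N : ℕ, ∀ (J : Instance S) (u v : ℕ), u ∈ adom J → v ∈ adom J → Forces E hE R J u v →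
      ∃ J₀ : Finset (Atom S ℕ), ↑J₀ ⊆ J ∧ J₀.card ≤ N ∧ Forces E hE R ↑J₀ u v := by
  obtain ⟨k, hk⟩ := h 2 (edgeQuery E hE)
  obtain ⟨N, hN⟩ := exists_finset_subset_mem_chaseStep hR k
  refine ⟨N, fun J u v hu hv huv => ?_⟩
  have ht : ∀ i, ![u, v] i ∈ adom J := by
    intro i
    fin_cases i
    · exact hu
    · exact hv
  have hb := edgeQuery_holds.1 ((hk J ![u, v] ht).1 (entails_edgeQuery.2 huv))
  obtain ⟨J₀, h₁, h₂, h₃⟩ := hN J _ hb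
  refine ⟨J₀, h₁, h₂, fun M A c hc hA => ?_⟩
  have := map_chaseHom_mem_of_mem_chaseStep (A := A) (c := c) ⟨hc, hA⟩ h₃
  rw [Atom.map_binary] at this
  exact this

/-- The disjunct of the rewriting that holds is turned into an instance: it forces the edge, as the
rewriting holds in it. -/
theorem exists_forces_of_isUCQRewritable {E : S.Pred} {hE : S.arity E = 2} {R : Set (Rule S)}
    (h : IsUCQRewritable R) :
    ∃ N : ℕ, ∀ (J : Instance S) (u v : ℕ), u ∈ adom J → v ∈ adom J → Forces E hE R J u v →
      ∃ J₀ : Finset (Atom S ℕ), ↑J₀ ⊆ J ∧ J₀.card ≤ N ∧ Forces E hE R ↑J₀ u v := by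
  classical
  obtain ⟨Q, hQ⟩ := h 2 (edgeQuery E hE)
  obtain ⟨N, hN⟩ := ((List.finite_toSet Q).image fun q => q.body.length).bddAbove
  refine ⟨N, fun J u v hu hv huv => ?_⟩
  have ht : ∀ i, ![u, v] i ∈ adom J := by
    intro i
    fin_cases i
    · exact hu
    · exact hv
  obtain ⟨q, hq, f, hf₁, hf₂⟩ := (hQ J ![u, v] ht).1 (entails_edgeQuery.2 huv)
  refine ⟨(q.body.map fun a => a.map f).toFinset, ?_, ?_, fun M A c hc hA => ?_⟩
  · intro x hx
    obtain ⟨a, ha, rfl⟩ := List.mem_map.1 (List.mem_toFinset.1 (Finset.mem_coe.1 hx))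
    exact hf₂ a ha
  · refine (List.toFinset_card_le _).trans ?_
    rw [List.length_map]
    exact hN ⟨q, hq, rfl⟩
  · have hq' : UCQ.Holds Q {a | a ∈ q.body} q.ans :=
      ⟨q, hq, id, fun _ => rfl, fun a ha => ha⟩
    have hent := entails_edgeQuery.1 ((hQ {a | a ∈ q.body} q.ans q.ans_mem).2 hq')
    have := hent M A (c ∘ f) (fun a ha => hc (a.map f)
      (Finset.mem_coe.2 (List.mem_toFinset.2 (List.mem_map.2 ⟨a, ha, rfl⟩)))) hA
    rw [Function.comp_apply, Function.comp_apply, hf₁, hf₁] at this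
    exact this

/-- Entailment of an edge is local: some `N` bounds the size of entailing sets of atoms that can be
found inside arbitrary finite ones. The two additional atoms keep `u` and `v` in the active domain.
-/
theorem exists_forces_finset {E : S.Pred} {hE : S.arity E = 2} {R : Set (Rule S)}
    (hR : R.Finite) (h : IsBDD R ∨ IsUCQRewritable R) (V : Type) :
    ∃ N : ℕ, ∀ (X : Set (Atom S V)) (u v : V), X.Finite → u ∈ adom X → v ∈ adom X →
      Forces E hE R X u v → ∃ X₀ : Finset (Atom S V), ↑X₀ ⊆ X ∧ X₀.card ≤ N ∧
        u ∈ adom (X₀ : Set (Atom S V)) ∧ v ∈ adom (X₀ : Set (Atom S V)) ∧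
        Forces E hE R ↑X₀ u v := by
  classical
  obtain ⟨N, hN⟩ := h.elim (exists_forces_of_isBDD (E := E) (hE := hE) hR)
    exists_forces_of_isUCQRewritable
  refine ⟨N + 2, fun X u v hX hu hv huv => ?_⟩
  obtain ⟨e, he⟩ := Set.countable_iff_exists_injOn.1 (finite_adom hX).countable
  have : Nonempty V := ⟨u⟩
  obtain ⟨d, hd⟩ : ∃ d : ℕ → V, ∀ t ∈ adom X, d (e t) = t :=
    ⟨Function.invFunOn e (adom X), fun t ht => he.leftInvOn_invFunOn ht⟩
  have hback : ∀ a ∈ X, (a.map e).map d = a := fun a ha =>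
    Atom.map_eq_self fun x hx => hd x ⟨a, ha, hx⟩
  have hadom : ∀ t ∈ adom X, e t ∈ adom ((fun a : Atom S V => a.map e) '' X) :=
    fun t ⟨a, ha, hta⟩ => ⟨_, ⟨a, ha, rfl⟩, Atom.mem_vars_map.2 ⟨t, hta, rfl⟩⟩
  obtain ⟨J, hJ₁, hJ₂, hJ₃⟩ := hN ((fun a : Atom S V => a.map e) '' X) (e u) (e v) (hadom u hu)
    (hadom v hv) fun M A c hc hA => huv M A (c ∘ e) (fun a ha => hc _ ⟨a, ha, rfl⟩) hA
  obtain ⟨a, ha, hua⟩ := hu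
  obtain ⟨b, hb, hvb⟩ := hv
  refine ⟨insert a (insert b (J.image fun a => a.map d)), ?_, ?_, ⟨a, by simp, hua⟩,
    ⟨b, by simp, hvb⟩, fun M A c hc hA => ?_⟩
  · intro x hx
    simp only [Finset.coe_insert, Finset.coe_image, Set.mem_insert_iff, Set.mem_image] at hx
    rcases hx with rfl | rfl | ⟨y, hy, rfl⟩
    · exact ha
    · exact hb
    · obtain ⟨x, hx, rfl⟩ := hJ₁ hy
      exact (hback x hx).symm ▸ hx
  · have h₁ := Finset.card_insert_le a (insert b (J.image fun a => a.map d))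
    have h₂ := Finset.card_insert_le b (J.image fun a => a.map d)
    have h₃ := Finset.card_image_le (s := J) (f := fun a => a.map d)
    omega
  · have := hJ₃ M A (c ∘ d) (fun x hx => hc (x.map d) ?_) hA
    · rwa [Function.comp_apply, Function.comp_apply, hd u ⟨a, ha, hua⟩, hd v ⟨b, hb, hvb⟩] at this
    · simp only [Finset.coe_insert, Finset.coe_image, Set.mem_insert_iff, Set.mem_image]
      exact Or.inr (Or.inr ⟨x, hx, rfl⟩)

/-! ### Core atoms of the chase -/

/-- The atoms of the instance together with all head atoms that contain an existential variable,
under arbitrary maps of the body variables. Within the chase they generate all other atoms, and a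
single fresh term of such an atom determines all its arguments. -/
def coreAtoms (I : Instance S) (R : Set (Rule S)) : Set (Atom S (ChaseTerm S)) :=
  {b | (∃ a ∈ I, b = a.map ChaseTerm.var) ∨ ∃ ρ ∈ R, ∃ h : ρ.bodyVars → ChaseTerm S, ∃ a ∈ ρ.head,
    (∃ z ∈ a.vars, z ∉ ρ.bodyVars) ∧ b = a.map (ρ.extend h)}

theorem map_mem_of_core {I : Instance S} {R : Set (Rule S)} {M : Type} {A : Set (Atom S M)}
    (hA : ∀ ρ ∈ R, ρ.Satisfied A) {c : ChaseTerm S → M} {k : ℕ}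
    (hc : ∀ b ∈ coreAtoms I R ∩ chaseStep I R k, b.map c ∈ A) :
    ∀ b ∈ chaseStep I R k, b.map c ∈ A := by
  induction k with
  | zero => exact fun b hb => hc b ⟨Or.inl hb, hb⟩
  | succ k ih =>
    have ih := ih fun b hb => hc b ⟨hb.1, Or.inl hb.2⟩
    intro b hb
    have hb' := hb
    rcases hb' with hb' | ⟨ρ, hρ, h, ht, a, ha, rfl⟩
    · exact ih b hb'
    · by_cases hz : ∃ z ∈ a.vars, z ∉ ρ.bodyVars
      · exact hc _ ⟨Or.inr ⟨ρ, hρ, h, a, ha, hz, rfl⟩, hb⟩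
      · push Not at hz
        obtain ⟨h', h₁, h₂⟩ := hA ρ hρ (c ∘ ρ.extend h) fun a ha => ih _ (ht a ha)
        rw [Atom.map_map, ← Atom.map_congr fun x hx => h₁ x (hz x hx)]
        exact h₂ a ha

theorem mem_adom_core {I : Instance S} {R : Set (Rule S)} {k : ℕ} {t : ChaseTerm S}
    (ht : t ∈ adom (chaseStep I R k)) : t ∈ adom (coreAtoms I R ∩ chaseStep I R k) := by
  induction k generalizing t with
  | zero =>
    obtain ⟨b, hb, htb⟩ := ht
    exact ⟨b, ⟨Or.inl hb, hb⟩, htb⟩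
  | succ k ih =>
    have old : t ∈ adom (chaseStep I R k) →
        t ∈ adom (coreAtoms I R ∩ chaseStep I R (k + 1)) := fun h =>
      adom_mono (Set.inter_subset_inter_right _ (chaseStep_mono (Nat.le_succ k))) (ih h)
    obtain ⟨b, hb, htb⟩ := ht
    have hb' := hb
    rcases hb' with hb' | ⟨ρ, hρ, h, htr, a, ha, rfl⟩
    · exact old ⟨b, hb', htb⟩
    · have htb' := htb
      obtain ⟨x, hxa, rfl⟩ := Atom.mem_vars_map.1 htb
      by_cases hx : x ∈ ρ.bodyVars
      · rw [Rule.extend_of_mem h hx] at old ⊢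
        exact old (htr.mem_adom ⟨x, hx⟩)
      · exact ⟨_, ⟨Or.inr ⟨ρ, hρ, h, a, ha, ⟨x, hxa, hx⟩, rfl⟩, hb⟩, htb'⟩

/-- If all atoms of `X` with a fresh term of the trigger `(ρ, h)` are produced by this trigger, then
they can be traded for the core of a chase step in which the trigger is applicable: a model of
the latter contains the image of the body of `ρ`, and the values that it provides for the head of
`ρ` may be used as values of the fresh terms. -/
theorem Forces.replace {E : S.Pred} {hE : S.arity E = 2} {I : Instance S} {R : Set (Rule S)}
    {X : Set (Atom S (ChaseTerm S))} {u v : ChaseTerm S} (hX : Forces E hE R X u v)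
    {ρ : Rule S} (hρ : ρ ∈ R) {h : ρ.bodyVars → ChaseTerm S} {k : ℕ}
    (ht : IsTrigger (chaseStep I R k) ρ h)
    (hpeak : ∀ b ∈ X, ∀ z, ChaseTerm.null ρ h z ∈ b.vars → ∃ a ∈ ρ.head, b = a.map (ρ.extend h))
    (hu : ∀ z, u ≠ ChaseTerm.null ρ h z) (hv : ∀ z, v ≠ ChaseTerm.null ρ h z) :
    Forces E hE R
      ({b ∈ X | ∀ z, ChaseTerm.null ρ h z ∉ b.vars} ∪ (coreAtoms I R ∩ chaseStep I R k)) u v := by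
  classical
  intro M A c hc hA
  have hk := map_mem_of_core hA fun b hb => hc b (Or.inr hb)
  obtain ⟨h', h₁, h₂⟩ := hA ρ hρ (c ∘ ρ.extend h) fun a ha => hk _ (ht a ha)
  set c' : ChaseTerm S → M := fun t =>
    if hz : ∃ z, t = ChaseTerm.null ρ h z then h' hz.choose else c t with hc'
  have fresh : ∀ z, c' (ChaseTerm.null ρ h z) = h' z := by
    intro z
    have hz : ∃ z', ChaseTerm.null ρ h z = ChaseTerm.null ρ h z' := ⟨z, rfl⟩
    have hzz : hz.choose = z := by
      have := hz.choose_spec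
      injection this with _ _ h₃
      exact h₃.symm
    rw [hc']
    simp only
    rw [dif_pos hz, hzz]
  have old : ∀ t, (∀ z, t ≠ ChaseTerm.null ρ h z) → c' t = c t := fun t ht =>
    dif_neg fun ⟨z, hz⟩ => ht z hz
  have hext : c' ∘ ρ.extend h = h' := by
    funext x
    by_cases hx : x ∈ ρ.bodyVars
    · rw [h₁ x hx, Function.comp_apply, Function.comp_apply, old]
      rw [Rule.extend_of_mem h hx]
      exact fun z => ChaseTerm.apply_ne_null ρ h z _
    · rw [Function.comp_apply, Rule.extend_of_notMem h hx, fresh]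
  have := hX M A c' (fun b hb => ?_) hA
  · rwa [old u hu, old v hv] at this
  · by_cases hz : ∃ z, ChaseTerm.null ρ h z ∈ b.vars
    · obtain ⟨z, hz⟩ := hz
      obtain ⟨a, ha, rfl⟩ := hpeak b hb z hz
      rw [Atom.map_map, hext]
      exact h₂ a ha
    · push Not at hz
      rw [Atom.map_congr (g := c) fun t htb => old t fun z hz' => hz z (hz' ▸ htb)]
      exact hc b (Or.inl ⟨hb, hz⟩)

/-- A sum of powers of `N + 1` decreases if a summand is replaced by at most `N` smaller ones. -/
theorem sum_pow_lt_sum_pow {α : Type} (stage : α → ℕ) {N k : ℕ} {X Y : Finset α}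
    {a : α} (ha : a ∈ X) (hk : k < stage a) (hY : Y.card ≤ N)
    (h : ∀ b ∈ Y, (b ∈ X ∧ b ≠ a) ∨ stage b ≤ k) :
    ∑ b ∈ Y, (N + 1) ^ stage b < ∑ b ∈ X, (N + 1) ^ stage b := by
  classical
  rw [← Finset.sum_filter_add_sum_filter_not Y (fun b => b ∈ X ∧ b ≠ a),
    ← Finset.sum_erase_add X _ ha]
  refine add_lt_add_of_le_of_lt ?_ ?_
  · refine Finset.sum_le_sum_of_subset fun b hb => ?_
    obtain ⟨-, h₁, h₂⟩ := Finset.mem_filter.1 hb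
    exact Finset.mem_erase.2 ⟨h₂, h₁⟩
  · calc _ ≤ (Y.filter fun b => ¬(b ∈ X ∧ b ≠ a)).card • (N + 1) ^ k := by
          refine Finset.sum_le_card_nsmul _ _ _ fun b hb => ?_
          obtain ⟨h₁, h₂⟩ := Finset.mem_filter.1 hb
          exact Nat.pow_le_pow_right (Nat.succ_pos N) ((h b h₁).resolve_left h₂)
      _ ≤ N * (N + 1) ^ k :=
          Nat.mul_le_mul_right _ ((Finset.card_filter_le _ _).trans hY)
      _ < (N + 1) ^ (k + 1) := by
          rw [pow_succ, mul_comm]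
          exact Nat.mul_lt_mul_of_pos_left (Nat.lt_succ_self N) (by positivity)
      _ ≤ (N + 1) ^ stage a := Nat.pow_le_pow_right (Nat.succ_pos N) hk

/-! ### Patterns of entailing sets of core atoms -/

/-- Where a core atom comes from: an atom of the instance, or an atom in the head of a rule. -/
inductive Source (S : Signature) : Type
  | fact (a : Atom S ℕ) : Source S
  | head (ρ : Rule S) (a : Atom S ℕ) : Source S

namespace Source

/-- The atom whose instantiations are the core atoms with the given source. -/
def atom : Source S → Atom S ℕ
  | fact a => a
  | head _ a => a

/-- The sources of the core atoms. -/
inductive Admissible (I : Instance S) (R : Set (Rule S)) : Source S → Prop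
  | fact (a : Atom S ℕ) (ha : a ∈ I) : Admissible I R (fact a)
  | head (ρ : Rule S) (hρ : ρ ∈ R) (a : Atom S ℕ) (ha : a ∈ ρ.head) (z : ℕ) (hz : z ∈ a.vars)
      (hz' : z ∉ ρ.bodyVars) : Admissible I R (head ρ a)

/-- The substitutions that produce core atoms. -/
inductive Instantiates : Source S → (ℕ → ChaseTerm S) → Prop
  | fact (a : Atom S ℕ) : Instantiates (fact a) ChaseTerm.var
  | head (ρ : Rule S) (a : Atom S ℕ) (h : ρ.bodyVars → ChaseTerm S) :
      Instantiates (head ρ a) (ρ.extend h)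

/-- `s.IsFresh g t` states that `t` is a fresh term of the trigger that is given by the rule of `s`
and the substitution `g`. -/
inductive IsFresh : Source S → (ℕ → ChaseTerm S) → ChaseTerm S → Prop
  | head (ρ : Rule S) (a : Atom S ℕ) (h : ρ.bodyVars → ChaseTerm S) (z : ℕ) :
      IsFresh (head ρ a) (ρ.extend h) (ChaseTerm.null ρ h z)

theorem IsFresh.unique {s : Source S} {g g' : ℕ → ChaseTerm S} {t : ChaseTerm S}
    (h : s.IsFresh g t) (h' : s.IsFresh g' t) : g = g' := by
  cases h
  cases h'
  rfl

theorem finite_admissible {I : Instance S} {R : Set (Rule S)} (hI : I.Finite) (hR : R.Finite) :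
    {s : Source S | s.Admissible I R}.Finite := by
  refine ((hI.image fact).union (hR.biUnion fun ρ _ =>
    (List.finite_toSet ρ.head).image (head ρ))).subset ?_
  rintro s (⟨a, ha⟩ | ⟨ρ, hρ, a, ha, -, -, -⟩)
  · exact Or.inl ⟨a, ha, rfl⟩
  · exact Or.inr (Set.mem_biUnion hρ ⟨a, ha, rfl⟩)

theorem exists_vars_lt {I : Instance S} {R : Set (Rule S)} (hI : I.Finite) (hR : R.Finite) :
    ∃ m : ℕ, ∀ s : Source S, s.Admissible I R → ∀ x ∈ s.atom.vars, x < m := by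
  obtain ⟨m, hm⟩ := ((finite_admissible hI hR).biUnion fun s _ =>
    Set.finite_range s.atom.args).bddAbove
  exact ⟨m + 1, fun s hs x hx => Nat.lt_succ_of_le (hm (Set.mem_biUnion hs hx))⟩

end Source

theorem exists_source_of_mem_coreAtoms {I : Instance S} {R : Set (Rule S)}
    {b : Atom S (ChaseTerm S)} (hb : b ∈ coreAtoms I R) :
    ∃ (s : {s : Source S // s.Admissible I R}) (g : ℕ → ChaseTerm S),
      s.1.Instantiates g ∧ s.1.atom.map g = b := by
  rcases hb with ⟨a, ha, rfl⟩ | ⟨ρ, hρ, h, a, ha, ⟨z, hz, hz'⟩, rfl⟩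
  · exact ⟨⟨.fact a, .fact a ha⟩, _, .fact a, rfl⟩
  · exact ⟨⟨.head ρ a, .head ρ hρ a ha z hz hz'⟩, _, .head ρ a h, rfl⟩

/-- The positions of a pair of terms and of `N` atoms with variables below `m`. -/
abbrev Node (N m : ℕ) : Type := Fin 2 ⊕ Fin N × Fin m

/-- The term at a position, for a pair of terms `p` and the substitutions `g` of `N` atoms. -/
def Node.val {N m : ℕ} (p : Fin 2 → ChaseTerm S) (g : Fin N → ℕ → ChaseTerm S) :
    Node N m → ChaseTerm S :=
  Sum.elim p fun q => g q.1 q.2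

/-- The isomorphism type of a pair of terms with `N` core atoms: the sources of the atoms, the
equalities between terms, and for every atom the positions that hold a fresh term of the trigger
that has produced this atom. -/
structure Pattern (I : Instance S) (R : Set (Rule S)) (N m : ℕ) where
  src : Fin N → {s : Source S // s.Admissible I R}
  eq : Node N m → Node N m → Prop
  fresh : Fin N → Node N m → Prop

theorem Pattern.finite {I : Instance S} {R : Set (Rule S)} (hI : I.Finite) (hR : R.Finite)
    (N m : ℕ) : Finite (Pattern I R N m) := by
  have : Finite {s : Source S // s.Admissible I R} := (Source.finite_admissible hI hR).to_subtype
  refine Finite.of_injective (fun c : Pattern I R N m => (c.src, c.eq, c.fresh)) ?_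
  rintro ⟨_, _, _⟩ ⟨_, _, _⟩ h
  simp only [Prod.mk.injEq] at h
  obtain ⟨rfl, rfl, rfl⟩ := h
  rfl

/-- The atom `i` is connected to the component `r` of the pair: it is an atom of the instance, or
one of the fresh terms of its trigger is that component or occurs in an atom that is connected to
it. -/
inductive Pattern.Connected {I : Instance S} {R : Set (Rule S)} {N m : ℕ} (c : Pattern I R N m)
    (r : Fin 2) : Fin N → Prop
  | fact (i : Fin N) (a : Atom S ℕ) (h : (c.src i).1 = .fact a) : c.Connected r i
  | root (i : Fin N) (h : c.fresh i (.inl r)) : c.Connected r i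
  | step (i j : Fin N) (y : Fin m) (h : c.fresh i (.inr (j, y))) (hj : c.Connected r j) :
      c.Connected r i

/-- The pair `p` and the substitutions `g` realize the pattern `c` in the chase, and the `N` atoms
obtained entail the edge from `p 0` to `p 1`. -/
structure Pattern.Realizes {I : Instance S} {R : Set (Rule S)} {N m : ℕ} (c : Pattern I R N m)
    (E : S.Pred) (hE : S.arity E = 2) (p : Fin 2 → ChaseTerm S) (g : Fin N → ℕ → ChaseTerm S) :
    Prop where
  inst : ∀ i, (c.src i).1.Instantiates (g i)
  eq_iff : ∀ n n', c.eq n n' ↔ Node.val p g n = Node.val p g n'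
  fresh_iff : ∀ i n, c.fresh i n ↔ (c.src i).1.IsFresh (g i) (Node.val p g n)
  mem : ∀ i, (c.src i).1.atom.map (g i) ∈ chase I R
  forces : Forces E hE R (Set.range fun i => (c.src i).1.atom.map (g i)) (p 0) (p 1)

/-- The arguments of an atom that is connected to a component of the pair are determined by this
component and the pattern. -/
theorem Pattern.Connected.eq_of_realizes {I : Instance S} {R : Set (Rule S)} {N m : ℕ}
    {c : Pattern I R N m} {E : S.Pred} {hE : S.arity E = 2} {p p' : Fin 2 → ChaseTerm S}
    {g g' : Fin N → ℕ → ChaseTerm S} (h : c.Realizes E hE p g) (h' : c.Realizes E hE p' g')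
    {r : Fin 2} (hr : p r = p' r) {i : Fin N} (hi : c.Connected r i) : g i = g' i := by
  induction hi with
  | fact i a hs =>
    have h₁ := h.inst i
    have h₂ := h'.inst i
    rw [hs] at h₁ h₂
    generalize g i = x at h₁
    generalize g' i = x' at h₂
    cases h₁
    cases h₂
    rfl
  | root i hf =>
    have h₁ := (h.fresh_iff i _).1 hf
    have h₂ := (h'.fresh_iff i _).1 hf
    simp only [Node.val, Sum.elim_inl] at h₁ h₂
    rw [hr] at h₁
    exact h₁.unique h₂
  | step i j y hf _ ih =>
    have h₁ := (h.fresh_iff i _).1 hf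
    have h₂ := (h'.fresh_iff i _).1 hf
    simp only [Node.val, Sum.elim_inr] at h₁ h₂
    rw [ih] at h₁
    exact h₁.unique h₂

/-! ### Edges of the chase realize connected patterns -/

/-- The first chase step that contains the atom (`0` if there is none). -/
noncomputable def stage (I : Instance S) (R : Set (Rule S)) (b : Atom S (ChaseTerm S)) : ℕ :=
  sInf {k | b ∈ chaseStep I R k}

theorem mem_chaseStep_stage {I : Instance S} {R : Set (Rule S)} {b : Atom S (ChaseTerm S)}
    (hb : b ∈ chase I R) : b ∈ chaseStep I R (stage I R b) := by
  obtain ⟨k, hk⟩ := Set.mem_iUnion.1 hb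
  exact Nat.sInf_mem (s := {k | b ∈ chaseStep I R k}) ⟨k, hk⟩

theorem stage_le {I : Instance S} {R : Set (Rule S)} {b : Atom S (ChaseTerm S)} {k : ℕ}
    (hb : b ∈ chaseStep I R k) : stage I R b ≤ k :=
  Nat.sInf_le hb

/-- Entailing sets of core atoms of the chase of size at most `N`. -/
structure IsEntailing (E : S.Pred) (hE : S.arity E = 2) (I : Instance S) (R : Set (Rule S)) (N : ℕ)
    (u v : ChaseTerm S) (X : Finset (Atom S (ChaseTerm S))) : Prop where
  core : ↑X ⊆ coreAtoms I R
  mem : ↑X ⊆ chase I R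
  card_le : X.card ≤ N
  left_mem : u ∈ adom (X : Set (Atom S (ChaseTerm S)))
  right_mem : v ∈ adom (X : Set (Atom S (ChaseTerm S)))
  forces : Forces E hE R ↑X u v

/-- Every edge of the chase is entailed by at most `N` core atoms of the chase that are connected
to its ends. They are chosen so that their stages are as small as possible, measured by a sum of
powers of `N + 1`. An unconnected atom of maximal stage would then be produced by a trigger whose
fresh terms occur in no atom from another trigger, and `Forces.replace` with subsequent
restriction to `N` atoms would decrease the measure. -/
theorem exists_realizes {E : S.Pred} {hE : S.arity E = 2} {I : Instance S} {R : Set (Rule S)}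
    (hI : I.Finite) (hR : R.Finite) {N m : ℕ}
    (hN : ∀ (X : Set (Atom S (ChaseTerm S))) (u v : ChaseTerm S), X.Finite → u ∈ adom X →
      v ∈ adom X → Forces E hE R X u v → ∃ X₀ : Finset (Atom S (ChaseTerm S)), ↑X₀ ⊆ X ∧
        X₀.card ≤ N ∧ u ∈ adom (X₀ : Set (Atom S (ChaseTerm S))) ∧
        v ∈ adom (X₀ : Set (Atom S (ChaseTerm S))) ∧ Forces E hE R ↑X₀ u v)
    (hm : ∀ s : Source S, s.Admissible I R → ∀ x ∈ s.atom.vars, x < m)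
    {u v : ChaseTerm S} (huv : Atom.binary E hE u v ∈ chase I R) :
    ∃ (c : Pattern I R N m) (g : Fin N → ℕ → ChaseTerm S), c.Realizes E hE ![u, v] g ∧
      ∀ i, c.Connected 0 i ∨ c.Connected 1 i := by
  classical
  -- A minimal entailing set of core atoms.
  have hex : ∃ X, IsEntailing E hE I R N u v X := by
    obtain ⟨k, hk⟩ := Set.mem_iUnion.1 huv
    obtain ⟨X, h₁, h₂, h₃, h₄, h₅⟩ := hN (coreAtoms I R ∩ chaseStep I R k) u v
      ((finite_chaseStep hI hR k).subset Set.inter_subset_right)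
      (mem_adom_core ⟨_, hk, Atom.left_mem_vars_binary E hE u v⟩)
      (mem_adom_core ⟨_, hk, Atom.right_mem_vars_binary E hE u v⟩)
      (fun M A c hc hA => by
        rw [← Atom.map_binary]
        exact map_mem_of_core hA hc _ hk)
    exact ⟨X, fun b hb => (h₁ hb).1, fun b hb => Set.mem_iUnion.2 ⟨k, (h₁ hb).2⟩, h₂, h₃, h₄, h₅⟩
  obtain ⟨X, hX, hmin⟩ : ∃ X, IsEntailing E hE I R N u v X ∧
      ∀ Y, IsEntailing E hE I R N u v Y →
        ∑ b ∈ X, (N + 1) ^ stage I R b ≤ ∑ b ∈ Y, (N + 1) ^ stage I R b := by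
    obtain ⟨X, hX, hmin⟩ := exists_minimalFor_of_wellFoundedLT (IsEntailing E hE I R N u v)
      (fun X => ∑ b ∈ X, (N + 1) ^ stage I R b) hex
    exact ⟨X, hX, fun Y hY => (le_total _ _).elim id fun h => hmin hY h⟩
  -- The set is enumerated by `Fin N`, with repetitions.
  obtain ⟨a, ha⟩ : ∃ a : Fin N → Atom S (ChaseTerm S), Set.range a = X := by
    obtain ⟨b, hb, -⟩ := hX.left_mem
    have : Nonempty X := ⟨⟨b, hb⟩⟩
    obtain ⟨e⟩ : Nonempty (X ↪ Fin N) :=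
      Function.Embedding.nonempty_of_card_le (by simpa using hX.card_le)
    refine ⟨fun i => (Function.invFun e i).1, ?_⟩
    change Set.range (Subtype.val ∘ Function.invFun e) = _
    rw [(Function.invFun_surjective e.injective).range_comp]
    ext b
    simp
  have haX : ∀ i, a i ∈ X := fun i => Finset.mem_coe.1 (ha ▸ Set.mem_range_self i)
  choose s g hg hsa using fun i => exists_source_of_mem_coreAtoms (hX.core (haX i))
  set c : Pattern I R N m :=
    { src := s
      eq := fun n n' => Node.val ![u, v] g n = Node.val ![u, v] g n'
      fresh := fun i n => (s i).1.IsFresh (g i) (Node.val ![u, v] g n) }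
  refine ⟨c, g, ⟨hg, fun _ _ => Iff.rfl, fun _ _ => Iff.rfl,
    fun i => (hsa i).symm ▸ hX.mem (haX i), ?_⟩, ?_⟩
  · have : (fun i => (s i).1.atom.map (g i)) = a := funext hsa
    change Forces E hE R (Set.range fun i => (s i).1.atom.map (g i)) u v
    rw [this, ha]
    exact hX.forces
  by_contra! hcon
  obtain ⟨i, ⟨hi₀, hi₁⟩, himax⟩ := Set.exists_max_image
    {i | ¬c.Connected 0 i ∧ ¬c.Connected 1 i} (fun i => stage I R (a i)) (Set.toFinite _) hcon
  -- The trigger `(ρ, h)` that has produced the atom `i`.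
  obtain ⟨ρ, hρ, α, hα, z, hz, hzb, h, hs, hgi⟩ : ∃ ρ ∈ R, ∃ α ∈ ρ.head, ∃ z ∈ α.vars,
      z ∉ ρ.bodyVars ∧ ∃ h : ρ.bodyVars → ChaseTerm S,
        (s i).1 = .head ρ α ∧ g i = ρ.extend h := by
    have h₁ := hg i
    have h₂ := (s i).2
    have h₃ : ∀ b, (s i).1 ≠ .fact b := fun b hb => hi₀ (.fact i b hb)
    generalize (s i).1 = σ at h₁ h₂ h₃
    generalize g i = γ at h₁
    cases h₁ with
    | fact b => exact absurd rfl (h₃ b)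
    | head ρ α h =>
      cases h₂ with
      | head _ hρ _ hα z hz hz' => exact ⟨ρ, hρ, α, hα, z, hz, hz', h, rfl, rfl⟩
  have hai : a i = α.map (ρ.extend h) := by
    rw [← hsa i, hs, hgi]
    rfl
  have hfresh : ∀ (n : Node N m) (w : ℕ), Node.val ![u, v] g n = ChaseTerm.null ρ h w →
      c.fresh i n := by
    intro n w hn
    change (s i).1.IsFresh (g i) (Node.val ![u, v] g n)
    rw [hn, hs, hgi]
    exact .head ρ α h w
  have hstage : ∀ k, IsTrigger (chaseStep I R k) ρ h → stage I R (a i) ≤ k + 1 := fun k hk =>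
    stage_le (Or.inr ⟨ρ, hρ, h, hk, α, hα, hai⟩)
  obtain ⟨k, hk, htk⟩ : ∃ k, stage I R (a i) = k + 1 ∧ IsTrigger (chaseStep I R k) ρ h := by
    refine exists_isTrigger_of_null_mem (z := z) ⟨a i, mem_chaseStep_stage (hX.mem (haX i)), ?_⟩
    rw [hai]
    exact Atom.mem_vars_map.2 ⟨z, hz, Rule.extend_of_notMem h hzb⟩
  have hpeak : ∀ b ∈ (X : Set (Atom S (ChaseTerm S))), ∀ w, ChaseTerm.null ρ h w ∈ b.vars →
      ∃ β ∈ ρ.head, b = β.map (ρ.extend h) := by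
    intro b hb w hw
    obtain ⟨j, rfl⟩ := (ha ▸ hb : b ∈ Set.range a)
    rw [← hsa j] at hw
    obtain ⟨y, hy, hyw⟩ := Atom.mem_vars_map.1 hw
    have hij : c.fresh i (.inr (j, ⟨y, hm _ (s j).2 y hy⟩)) := hfresh _ w hyw
    have hj := himax j ⟨fun h => hi₀ (.step i j _ hij h), fun h => hi₁ (.step i j _ hij h)⟩
    clear hij
    have hjm := mem_chaseStep_stage (hX.mem (haX j))
    have h₁ := hg j
    have h₂ := (s j).2
    have h₃ := hsa j
    generalize (s j).1 = σ at h₁ h₂ h₃ hy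
    generalize g j = γ at h₁ h₃ hyw
    cases h₁ with
    | fact b => cases hyw
    | head ρ' β h' =>
      cases h₂ with
      | head _ hρ' _ hβ z' hz' hzb' =>
        by_cases hyb : y ∈ ρ'.bodyVars
        · exfalso
          rw [Rule.extend_of_mem h' hyb] at hyw
          obtain ⟨l, hl, htl⟩ : ∃ l, stage I R (a j) = l + 1 ∧
              IsTrigger (chaseStep I R l) ρ' h' := by
            refine exists_isTrigger_of_null_mem (z := z') ⟨a j, hjm, ?_⟩
            rw [← h₃]
            exact Atom.mem_vars_map.2 ⟨z', hz', Rule.extend_of_notMem h' hzb'⟩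
          obtain ⟨l', hl', htl'⟩ := exists_isTrigger_of_null_mem (hyw ▸ htl.mem_adom ⟨y, hyb⟩)
          have := hstage l' htl'
          omega
        · rw [Rule.extend_of_notMem h' hyb] at hyw
          cases hyw
          exact ⟨β, hβ, h₃.symm⟩
  have hu : ∀ w, u ≠ ChaseTerm.null ρ h w := fun w hw => hi₀ (.root i (hfresh (.inl 0) w hw))
  have hv : ∀ w, v ≠ ChaseTerm.null ρ h w := fun w hw => hi₁ (.root i (hfresh (.inl 1) w hw))
  have hadom : ∀ t, (∀ w, t ≠ ChaseTerm.null ρ h w) → t ∈ adom (X : Set (Atom S (ChaseTerm S))) →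
      t ∈ adom ({b ∈ (X : Set (Atom S (ChaseTerm S))) | ∀ w, ChaseTerm.null ρ h w ∉ b.vars} ∪
        (coreAtoms I R ∩ chaseStep I R k)) := by
    rintro t ht ⟨b, hb, htb⟩
    by_cases hw : ∃ w, ChaseTerm.null ρ h w ∈ b.vars
    · obtain ⟨w, hw⟩ := hw
      obtain ⟨β, -, rfl⟩ := hpeak b hb w hw
      obtain ⟨x, -, rfl⟩ := Atom.mem_vars_map.1 htb
      by_cases hx : x ∈ ρ.bodyVars
      · rw [Rule.extend_of_mem h hx]
        exact adom_mono Set.subset_union_right (mem_adom_core (htk.mem_adom ⟨x, hx⟩))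
      · exact absurd (Rule.extend_of_notMem h hx) (ht x)
    · push Not at hw
      exact ⟨b, Or.inl ⟨hb, hw⟩, htb⟩
  obtain ⟨Y, hY₁, hY₂, hY₃, hY₄, hY₅⟩ := hN _ u v
    ((X.finite_toSet.subset (Set.sep_subset _ _)).union
      ((finite_chaseStep hI hR k).subset Set.inter_subset_right))
    (hadom u hu hX.left_mem) (hadom v hv hX.right_mem) (hX.forces.replace hρ htk hpeak hu hv)
  have hYe : IsEntailing E hE I R N u v Y := by
    refine ⟨fun b hb => ?_, fun b hb => ?_, hY₂, hY₃, hY₄, hY₅⟩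
    · exact (hY₁ hb).elim (fun h => hX.core h.1) fun h => h.1
    · exact (hY₁ hb).elim (fun h => hX.mem h.1) fun h => Set.mem_iUnion.2 ⟨k, h.2⟩
  refine (hmin Y hYe).not_gt (sum_pow_lt_sum_pow (stage I R) (haX i) (k := k) (by omega) hY₂ ?_)
  intro b hb
  rcases hY₁ hb with ⟨h₁, h₂⟩ | h
  · refine Or.inl ⟨h₁, ?_⟩
    rintro rfl
    refine h₂ z ?_
    rw [hai]
    exact Atom.mem_vars_map.2 ⟨z, hz, Rule.extend_of_notMem h hzb⟩
  · exact Or.inr (stage_le h.2)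

/-! ### Transitive triangles and loops -/

/-- A transitive triangle `a → b`, `a → d`, `b → d` whose three edges realize the same connected
pattern gives a loop at `b`: of the atoms that entail the first edge, those connected to `a` are
replaced by the corresponding atoms for the third edge. The second edge ensures that this is
consistent, as terms that are connected to both ends agree for all three edges. -/
theorem loop_mem_chase_of_triangle {E : S.Pred} {hE : S.arity E = 2} {I : Instance S}
    {R : Set (Rule S)} {N m : ℕ} {c : Pattern I R N m}
    (hm : ∀ s : Source S, s.Admissible I R → ∀ x ∈ s.atom.vars, x < m)
    (hc : ∀ i, c.Connected 0 i ∨ c.Connected 1 i) {a b d : ChaseTerm S}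
    {g₁ g₂ g₃ : Fin N → ℕ → ChaseTerm S} (h₁ : c.Realizes E hE ![a, b] g₁)
    (h₂ : c.Realizes E hE ![a, d] g₂) (h₃ : c.Realizes E hE ![b, d] g₃) :
    Atom.binary E hE b b ∈ chase I R := by
  classical
  -- The positions that are determined by the first component of the pair.
  set P : Node N m → Prop := Sum.elim (fun r => r = 0) fun q => c.Connected 0 q.1
  set r : Node N m → ChaseTerm S := fun n =>
    if P n then Node.val ![b, d] g₃ n else Node.val ![a, b] g₁ n with hr
  have left : ∀ n, P n → Node.val ![a, b] g₁ n = Node.val ![a, d] g₂ n := by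
    rintro (i | ⟨i, x⟩) hn
    · obtain rfl : i = 0 := hn
      rfl
    · exact congrFun (Pattern.Connected.eq_of_realizes h₁ h₂ rfl hn) _
  have right : ∀ n, ¬P n → Node.val ![a, d] g₂ n = Node.val ![b, d] g₃ n := by
    rintro (i | ⟨i, x⟩) hn
    · obtain rfl : i = 1 := by
        have : i ≠ 0 := hn
        omega
      rfl
    · exact congrFun (Pattern.Connected.eq_of_realizes h₂ h₃ rfl ((hc i).resolve_left hn)) _
  have mixed : ∀ n n', P n → ¬P n' → Node.val ![a, b] g₁ n = Node.val ![a, b] g₁ n' →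
      Node.val ![b, d] g₃ n = Node.val ![a, b] g₁ n' := by
    intro n n' hn hn' h
    have heq := (h₁.eq_iff n n').2 h
    rw [(h₃.eq_iff n n').1 heq, ← right n' hn', ← (h₂.eq_iff n n').1 heq, ← left n hn, h]
  have hfac : Function.FactorsThrough r (Node.val ![a, b] g₁) := by
    intro n n' h
    by_cases hn : P n <;> by_cases hn' : P n'
    · simp only [hr, if_pos hn, if_pos hn']
      exact (h₃.eq_iff n n').1 ((h₁.eq_iff n n').2 h)
    · simp only [hr, if_pos hn, if_neg hn']
      exact mixed n n' hn hn' h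
    · simp only [hr, if_neg hn, if_pos hn']
      exact (mixed n' n hn' hn h.symm).symm
    · simp only [hr, if_neg hn, if_neg hn']
      exact h
  set θ : ChaseTerm S → ChaseTerm S := Function.extend (Node.val ![a, b] g₁) r id
  have hθr : ∀ n, θ (Node.val ![a, b] g₁ n) = r n := fun n => hfac.extend_apply _ n
  have ha : θ a = b := (hθr (.inl 0)).trans (if_pos rfl)
  have hb : θ b = b := (hθr (.inl 1)).trans (if_neg one_ne_zero)
  have := h₁.forces _ (chase I R) θ ?_ (isModel_chase I R).rules
  · change Atom.binary E hE (θ a) (θ b) ∈ _ at this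
    rwa [ha, hb] at this
  · rintro _ ⟨i, rfl⟩
    change Atom.map (θ ∘ g₁ i) _ ∈ _
    by_cases hi : c.Connected 0 i
    · rw [Atom.map_congr (g := g₃ i)]
      · exact h₃.mem i
      · intro x hx
        exact (hθr (.inr (i, ⟨x, hm _ (c.src i).2 x hx⟩))).trans (if_pos hi)
    · rw [Atom.map_congr (g := g₁ i)]
      · exact h₁.mem i
      · intro x hx
        exact (hθr (.inr (i, ⟨x, hm _ (c.src i).2 x hx⟩))).trans (if_neg hi)

/-- Ramsey's theorem for triangles and finitely many colours. -/
theorem exists_monochromatic_triangle {K : Type} (C : Finset K) :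
    ∃ n : ℕ, ∀ (ι : Type) [LinearOrder ι] (V : Finset ι) (χ : ι → ι → K), n ≤ V.card →
      (∀ i ∈ V, ∀ j ∈ V, i < j → χ i j ∈ C) →
      ∃ i j l, i < j ∧ j < l ∧ χ i l = χ i j ∧ χ j l = χ i j := by
  classical
  induction C using Finset.strongInduction with
  | H C ih =>
    have hch : ∃ F : K → ℕ, ∀ x ∈ C, ∀ (ι : Type) [LinearOrder ι] (V : Finset ι) (χ : ι → ι → K),
        F x ≤ V.card → (∀ i ∈ V, ∀ j ∈ V, i < j → χ i j ∈ C.erase x) →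
        ∃ i j l, i < j ∧ j < l ∧ χ i l = χ i j ∧ χ j l = χ i j := by
      have : ∀ x, ∃ n : ℕ, x ∈ C → ∀ (ι : Type) [LinearOrder ι] (V : Finset ι) (χ : ι → ι → K),
          n ≤ V.card → (∀ i ∈ V, ∀ j ∈ V, i < j → χ i j ∈ C.erase x) →
          ∃ i j l, i < j ∧ j < l ∧ χ i l = χ i j ∧ χ j l = χ i j := by
        intro x
        by_cases hx : x ∈ C
        · obtain ⟨n, hn⟩ := ih _ (Finset.erase_ssubset hx)
          exact ⟨n, fun _ => hn⟩
        · exact ⟨0, fun h => absurd h hx⟩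
      choose F hF using this
      exact ⟨F, hF⟩
    obtain ⟨F, hF⟩ := hch
    refine ⟨∑ x ∈ C, F x + 2, fun ι _ V χ hV hχ => ?_⟩
    obtain ⟨v, hv, hmin⟩ := V.exists_min_image id (Finset.card_pos.1 (by omega))
    have hlt : ∀ w ∈ V.erase v, v < w := fun w hw =>
      lt_of_le_of_ne (hmin w (Finset.mem_of_mem_erase hw)) (Finset.ne_of_mem_erase hw).symm
    -- Some colour class at the least vertex is large.
    obtain ⟨x, hx, hcard⟩ : ∃ x ∈ C, F x < {w ∈ V.erase v | χ v w = x}.card := by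
      by_contra! hcon
      have h₁ := Finset.card_eq_sum_card_fiberwise (s := V.erase v) (t := C) (f := fun w => χ v w)
        fun w hw => hχ v hv w (Finset.mem_of_mem_erase hw) (hlt w hw)
      have h₂ := Finset.sum_le_sum hcon
      rw [Finset.card_erase_of_mem hv] at h₁
      omega
    by_cases hmono : ∃ i ∈ {w ∈ V.erase v | χ v w = x}, ∃ j ∈ {w ∈ V.erase v | χ v w = x},
        i < j ∧ χ i j = x
    · obtain ⟨i, hi, j, hj, hij, hχij⟩ := hmono
      rw [Finset.mem_filter] at hi hj
      exact ⟨v, i, j, hlt i hi.1, hij, by rw [hi.2, hj.2], by rw [hi.2, hχij]⟩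
    · push Not at hmono
      refine hF x hx ι _ χ hcard.le fun i hi j hj hij =>
        Finset.mem_erase.2 ⟨hmono i hi j hj hij, ?_⟩
      exact hχ i (Finset.mem_of_mem_erase (Finset.mem_filter.1 hi).1) j
        (Finset.mem_of_mem_erase (Finset.mem_filter.1 hj).1) hij

theorem hasLoop_chase {E : S.Pred} {hE : S.arity E = 2} {R : Set (Rule S)} (hR : R.Finite)
    (hbdd : IsBDD R ∨ IsUCQRewritable R) {I : Instance S} (hI : I.Finite)
    (hT : ∀ k, TournamentQuery E hE (chase I R) k) : HasLoop E hE (chase I R) := by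
  obtain ⟨N, hN⟩ := exists_forces_finset (E := E) (hE := hE) hR hbdd (ChaseTerm S)
  obtain ⟨m, hm⟩ := Source.exists_vars_lt hI hR
  have hcol : ∀ {u v}, Atom.binary E hE u v ∈ chase I R → ∃ c : Pattern I R N m,
      (∀ i, c.Connected 0 i ∨ c.Connected 1 i) ∧ ∃ g, c.Realizes E hE ![u, v] g := by
    intro u v huv
    obtain ⟨c, g, h₁, h₂⟩ := exists_realizes hI hR hN hm huv
    exact ⟨c, h₂, g, h₁⟩
  have := Pattern.finite hI hR N m
  have := Fintype.ofFinite (Pattern I R N m)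
  obtain ⟨n, hn⟩ := exists_monochromatic_triangle
    (Finset.univ : Finset (Option (Pattern I R N m ⊕ Pattern I R N m)))
  obtain ⟨x, hx⟩ := hT n
  -- The summand of a colour is the direction of the edge; `none` is used outside of `i < j`.
  have hχ : ∀ i j : Fin n, ∃ o : Option (Pattern I R N m ⊕ Pattern I R N m), i < j →
      ∃ c : Pattern I R N m, (∀ i, c.Connected 0 i ∨ c.Connected 1 i) ∧
        ((o = some (.inl c) ∧ ∃ g, c.Realizes E hE ![x i, x j] g) ∨
          (o = some (.inr c) ∧ ∃ g, c.Realizes E hE ![x j, x i] g)) := by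
    intro i j
    by_cases hij : i < j
    · rcases hx i j hij.ne with h | h
      · obtain ⟨c, h₁, h₂⟩ := hcol h
        exact ⟨some (.inl c), fun _ => ⟨c, h₁, Or.inl ⟨rfl, h₂⟩⟩⟩
      · obtain ⟨c, h₁, h₂⟩ := hcol h
        exact ⟨some (.inr c), fun _ => ⟨c, h₁, Or.inr ⟨rfl, h₂⟩⟩⟩
    · exact ⟨none, fun h => absurd h hij⟩
  choose χ hχ using hχ
  obtain ⟨i, j, l, hij, hjl, h₁, h₂⟩ := hn (Fin n) Finset.univ χ (by simp) (by simp)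
  obtain ⟨c, hc, hcij⟩ := hχ i j hij
  obtain ⟨c₁, -, hcil⟩ := hχ i l (hij.trans hjl)
  obtain ⟨c₂, -, hcjl⟩ := hχ j l hjl
  rw [h₁] at hcil
  rw [h₂] at hcjl
  refine ⟨x j, ?_⟩
  rcases hcij with ⟨h, g₁, hg₁⟩ | ⟨h, g₁, hg₁⟩
  · simp only [h, Option.some.injEq, Sum.inl.injEq, reduceCtorEq, false_and, or_false]
      at hcil hcjl
    obtain ⟨rfl, g₂, hg₂⟩ := hcil
    obtain ⟨rfl, g₃, hg₃⟩ := hcjl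
    exact loop_mem_chase_of_triangle hm hc hg₁ hg₂ hg₃
  · simp only [h, Option.some.injEq, Sum.inr.injEq, reduceCtorEq, false_and, false_or]
      at hcil hcjl
    obtain ⟨rfl, g₂, hg₂⟩ := hcil
    obtain ⟨rfl, g₃, hg₃⟩ := hcjl
    exact loop_mem_chase_of_triangle hm hc hg₃ hg₂ hg₁

theorem entailsLoop_of_hasLoop_chase {E : S.Pred} {hE : S.arity E = 2} {I : Instance S}
    {R : Set (Rule S)} (h : HasLoop E hE (chase I R)) : EntailsLoop E hE I R := by
  intro M A c hA
  obtain ⟨x, hx⟩ := h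
  obtain ⟨k, hk⟩ := Set.mem_iUnion.1 hx
  refine ⟨chaseHom A c x, ?_⟩
  rw [← Atom.map_binary]
  exact map_chaseHom_mem_of_mem_chaseStep hA hk

end ExRules

theorem theorem1 (S : ExRules.Signature) (E : S.Pred) (hE : S.arity E = 2)
    (R : Set (ExRules.Rule S)) (hR : R.Finite)
    (hbdd : ExRules.IsBDD R ∨ ExRules.IsUCQRewritable R)
    (I : ExRules.Instance S) (hI : I.Finite) :
    (ExRules.EntailsTournaments E hE I R → ExRules.EntailsLoop E hE I R) ∧
    (∀ (U : Type) (A : Set (ExRules.Atom S U)) (c : ℕ → U),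
      ExRules.IsUniversalModel I R A c →
      (∀ k : ℕ, ExRules.ContainsTournament E hE A k) → ExRules.HasLoop E hE A) := by
  refine ⟨fun hT => ExRules.entailsLoop_of_hasLoop_chase
    (ExRules.hasLoop_chase hR hbdd hI (hT _ _ _ (ExRules.isModel_chase I R))), ?_⟩
  intro U A c hU hT
  refine ExRules.entailsLoop_of_hasLoop_chase
    (ExRules.hasLoop_chase hR hbdd hI fun k => ?_) U A c hU.1
  -- A homomorphism need not be injective on a tournament, but it preserves the tournament query.
  obtain ⟨f, hf⟩ := hU.2 _ _ _ (ExRules.isModel_chase I R)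
  obtain ⟨T, rfl, hT⟩ := hT k
  refine ⟨fun i => f (T.equivFin.symm i), fun i j hij => ?_⟩
  have hne : (T.equivFin.symm i : U) ≠ T.equivFin.symm j := fun h =>
    hij (T.equivFin.symm.injective (Subtype.ext h))
  refine (hT _ (T.equivFin.symm i).2 _ (T.equivFin.symm j).2 hne).imp (fun h => ?_) fun h => ?_
  all_goals
    have := hf _ h
    rwa [ExRules.Atom.map_binary] at this
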